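/- Let $K=\mathbb R$ or $K=\mathbb C$ and let $n\ge 4$ (the case $n=4$ being trivial). A camera is a matrix $C\in K^{3\times 4}$ whose left $3\times 3$ block is invertible; the image of a point $P\in K^3$ is $q\equiv C\binom{P}{1}$, where $\equiv$ denotes equality of non-zero vectors of $K^3$ up to a non-zero scalar. We say that a camera $C$, an affine map $T(P)=AP+t$ with $\det A\neq 0$, and points $P_0,\dots,P_{n-1}\in K^3$ such that $P_0,P_1,P_2,P_3$ form an affine basis of $K^3$, produce the three images $(q_i),(q_i'),(q_i'')$, $0\le i\le n-1$, if for all $i$ $$q_i\equiv C\binom{P_i}{1},\qquad q_i'\equiv C\binom{T(P_i)}{1},\qquad q_i''\equiv C\binom{T(T(P_i))}{1}.$$ The affine invariant structure of such points is the family $(\alpha_i,\beta_i,\gamma_i)_{4\le i\le n-1}$ defined by $$P_i=\alpha_iP_0+\beta_iP_1+\gamma_iP_2+(1-\alpha_i-\beta_i-\gamma_i)P_3 .$$ Theorem. If generic points undergo the same generic affine deformation twice, their affine invariant structure is determined by the three images up to a finite ambiguity, without calibration of the camera. Precisely: for every camera $C$ there is a non-zero polynomial $p$ over $K$ in the entries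 of $A$, $t$, $P_0,\dots,P_{n-1}$ such that, whenever $p(A,t,P_0,\dots,P_{n-1})\neq 0$ and $C$, $(A,t)$, $(P_i)$ produce the images $(q_i),(q_i'),(q_i'')$, the set of all affine invariant structures $(\hat\alpha_i,\hat\beta_i,\hat\gamma_i)_{4\le i\le n-1}$ of points $\hat P_0,\dots,\hat P_{n-1}$ which, together with some camera $\hat C$ and some invertible affine deformation $(\hat A,\hat t)$, produce the same three images $(q_i),(q_i'),(q_i'')$ is finite. -/

import Mathlib

open scoped Matrix

namespace DeformingScene

variable {K : Type*} [RCLike K]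

/-- Homogeneous coordinates, with last coordinate `1`, of a point of affine 3-space. -/
def homog (P : Fin 3 → K) : Fin 4 → K := ![P 0, P 1, P 2, 1]

/-- A pinhole camera `C = [M; c]`: a `3 × 4` matrix whose left `3 × 3` block `M` is invertible,
i.e. a projection from a centre at finite distance, with arbitrary internal and external
parameters. -/
def IsPinholeCamera (C : Matrix (Fin 3) (Fin 4) K) : Prop :=
  (C.submatrix id (Fin.castSucc : Fin 3 → Fin 4)).det ≠ 0

/-- `q` is a homogeneous coordinate vector of the image of the point `P` by the camera `C`:
`q` is non-zero and equal to `C P` up to a non-zero scalar. -/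
def IsImage (C : Matrix (Fin 3) (Fin 4) K) (P q : Fin 3 → K) : Prop :=
  q ≠ 0 ∧ ∃ c : K, c ≠ 0 ∧ q = c • (C *ᵥ homog P)

/-- The affine deformation `P ↦ A P + t`. -/
def deform (A : Matrix (Fin 3) (Fin 3) K) (t P : Fin 3 → K) : Fin 3 → K := A *ᵥ P + t

/-- The fixed camera `C`, the invertible affine deformation `(A, t)` and the points `P i`, the first
four of which form an affine basis of 3-space, produce the images `q`, `q'`, `q''` of the points,
respectively before the deformation, after applying it once and after applying it twice. -/
structure Produces {m : ℕ} (C : Matrix (Fin 3) (Fin 4) K) (A : Matrix (Fin 3) (Fin 3) K)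
    (t : Fin 3 → K) (P : Fin (4 + m) → Fin 3 → K) (q q' q'' : Fin (4 + m) → Fin 3 → K) : Prop where
  camera : IsPinholeCamera C
  invertible : A.det ≠ 0
  basis : AffineIndependent K (fun j : Fin 4 => P (Fin.castAdd m j))
  image₁ : ∀ i, IsImage C (P i) (q i)
  image₂ : ∀ i, IsImage C (deform A t (P i)) (q' i)
  image₃ : ∀ i, IsImage C (deform A t (deform A t (P i))) (q'' i)

/-- `κ i = (α, β, γ)` are the affine coordinates of the point number `4 + i` relative to the
first four points. -/
def HasAffineCoords {m : ℕ} (P : Fin (4 + m) → Fin 3 → K) (κ : Fin m → Fin 3 → K) : Prop :=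
  ∀ i : Fin m, P (Fin.natAdd 4 i) =
    κ i 0 • P (Fin.castAdd m 0) + κ i 1 • P (Fin.castAdd m 1) + κ i 2 • P (Fin.castAdd m 2)
      + (1 - κ i 0 - κ i 1 - κ i 2) • P (Fin.castAdd m 3)

/-- The affine invariant structures compatible with three given images `q`, `q'`, `q''`, when the
camera, the points and the (twice repeated) deformation are all unknown. -/
def affineStructures {m : ℕ} (q q' q'' : Fin (4 + m) → Fin 3 → K) : Set (Fin m → Fin 3 → K) :=
  {κ | ∃ (C : Matrix (Fin 3) (Fin 4) K) (A : Matrix (Fin 3) (Fin 3) K) (t : Fin 3 → K)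
      (P : Fin (4 + m) → Fin 3 → K), Produces C A t P q q' q'' ∧ HasAffineCoords P κ}

/-- Index set for the entries of `A`, of `t` and of all the points. -/
abbrev ParamIndex (m : ℕ) : Type := (Fin 3 × Fin 3) ⊕ Fin 3 ⊕ (Fin (4 + m) × Fin 3)

/-- The vector of all the entries of `A`, of `t` and of all the points. -/
def params {m : ℕ} (A : Matrix (Fin 3) (Fin 3) K) (t : Fin 3 → K) (P : Fin (4 + m) → Fin 3 → K) :
    ParamIndex m → K :=
  Sum.elim (fun ij => A ij.1 ij.2) (Sum.elim t (fun ik => P ik.1 ik.2))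

end DeformingScene

/-! In affine coordinates where the camera is `[1; 0]`, an image point is a scalar multiple of the
position it depicts. Treating these scalars as unknowns makes imaging a polynomial map
`genericImages`. Scaling all of space about the camera centre is invisible, so one scalar is
recorded as an extra output to remove this freedom. If the Jacobian of a polynomial map is injective
at one point, every variable is algebraic over the algebra of its outputs: the function field is
unramified over the field they generate. Hence generic fibres are finite. One explicit scene
supplies such a point. Every competing reconstruction, suitably rescaled, lies in the fibre of the
true scene, and its affine structure is a function of that fibre point. -/

/-! ### Jacobian criterion for generically finite fibres -/

/-- If the specialization of `J` to a field is injective, some constant matrix is a left inverse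
of `J` up to a matrix with non-zero determinant. -/
theorem Matrix.exists_mul_det_ne_zero_of_map_injective {R K : Type*} [CommRing R] [Field K]
    [Algebra K R] {ι σ : Type*} [Fintype ι] [Fintype σ] [DecidableEq ι] [DecidableEq σ]
    (φ : R →ₐ[K] K) (J : Matrix ι σ R)
    (hJ : ∀ v : σ → K, (J.map φ) *ᵥ v = 0 → v = 0) :
    ∃ N : Matrix σ ι K, ((N.map (algebraMap K R)) * J).det ≠ 0 := by
  have hinj : Function.Injective (J.map φ).mulVec := by
    intro v w h
    have : (J.map φ) *ᵥ (v - w) = 0 := by rw [Matrix.mulVec_sub, h, sub_self]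
    exact sub_eq_zero.mp (hJ _ this)
  obtain ⟨g, hg⟩ := (J.map φ).mulVecLin.exists_leftInverse_of_injective
    (LinearMap.ker_eq_bot.mpr hinj)
  obtain ⟨N, hN⟩ : ∃ N : Matrix σ ι K, N * J.map φ = 1 := by
    refine ⟨LinearMap.toMatrix' g, ?_⟩
    have := congrArg LinearMap.toMatrix' hg
    rwa [LinearMap.toMatrix'_comp, ← Matrix.toLin'_apply', LinearMap.toMatrix'_toLin',
      LinearMap.toMatrix'_id] at this
  refine ⟨N, fun h => ?_⟩
  have h1 : φ ((N.map (algebraMap K R)) * J).det = 0 := by rw [h, map_zero]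
  rw [AlgHom.map_det] at h1
  have h2 : φ.mapMatrix ((N.map (algebraMap K R)) * J) = 1 := by
    rw [← hN]
    ext i j
    simp [Matrix.mul_apply]
  rw [h2, Matrix.det_one] at h1
  exact one_ne_zero h1

namespace MvPolynomial

open scoped IntermediateField.algebraAdjoinAdjoin KaehlerDifferential

variable {K : Type*} [Field K] {σ ι : Type*} [Fintype σ] [Fintype ι]

/-- A derivation of a polynomial ring is determined by its values at the variables. -/
theorem derivation_eq_sum_pderiv {K σ M : Type*} [CommSemiring K] [Fintype σ] [AddCommMonoid M]
    [Module K M] [Module (MvPolynomial σ K) M] [IsScalarTower K (MvPolynomial σ K) M]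
    (d : Derivation K (MvPolynomial σ K) M) (g : MvPolynomial σ K) :
    d g = ∑ j, pderiv j g • d (X j) := by
  classical
  induction g using MvPolynomial.induction_on with
  | C a => simp
  | add p q hp hq => simp only [map_add, hp, hq, add_smul, Finset.sum_add_distrib]
  | mul_X p i hp =>
    simp only [Derivation.leibniz, hp, pderiv_X, add_smul, Finset.sum_add_distrib,
      Finset.smul_sum, smul_eq_mul, mul_smul]
    congr 1
    rw [Finset.sum_eq_single i]
    · simp
    · intro j _ hj
      simp [hj.symm]
    · simp

/-- If the Jacobian matrix of the polynomials `f i` is injective at one point, every variable is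
algebraic over the algebra they generate. -/
theorem isAlgebraic_X_adjoin_of_jacobian [CharZero K] (f : ι → MvPolynomial σ K) (a : σ → K)
    (hJ : ∀ v : σ → K,
      (∀ i, eval a (mkDerivation K (fun j => (C (v j) : MvPolynomial σ K)) (f i)) = 0) → v = 0)
    (j : σ) : IsAlgebraic (Algebra.adjoin K (Set.range f)) (X j : MvPolynomial σ K) := by
  classical
  let R := MvPolynomial σ K
  let L := FractionRing R
  let F : Set L := algebraMap R L '' Set.range f
  let k : IntermediateField K L := IntermediateField.adjoin K F
  obtain ⟨N, hN⟩ := Matrix.exists_mul_det_ne_zero_of_map_injective (aeval a)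
    (Matrix.of fun i j => pderiv j (f i)) (by
      intro v hv
      refine hJ v fun i => ?_
      have := congrFun hv i
      rw [derivation_eq_sum_pderiv]
      simpa [Matrix.mulVec, dotProduct, mul_comm, coe_aeval_eq_eval] using this)
  -- Chain rule: restricted to polynomials, the universal derivation is still a derivation over `K`.
  have hD : ∀ r : R, KaehlerDifferential.D k L (algebraMap R L r) =
      ∑ j, algebraMap R L (pderiv j r) • KaehlerDifferential.D k L (algebraMap R L (X j)) := by
    intro r
    let d : Derivation K R (Ω[L⁄k]) :=
      ((KaehlerDifferential.D k L).restrictScalars K).compAlgebraMap R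
    have := derivation_eq_sum_pderiv d r
    simp only [algebraMap_smul]
    exact this
  have hf : ∀ i, KaehlerDifferential.D k L (algebraMap R L (f i)) = 0 := fun i =>
    (KaehlerDifferential.D k L).map_algebraMap
      (⟨algebraMap R L (f i), IntermediateField.subset_adjoin K F ⟨f i, ⟨i, rfl⟩, rfl⟩⟩ : k)
  have hX : ∀ j, KaehlerDifferential.D k L (algebraMap R L (X j)) = 0 := by
    let P := (N.map (algebraMap K R)) * Matrix.of fun i j => pderiv j (f i)
    have hP : ∀ l, ∑ j, algebraMap R L (P l j) •
        KaehlerDifferential.D k L (algebraMap R L (X j)) = 0 := by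
      intro l
      have : ∀ i, ∑ j, algebraMap R L (algebraMap K R (N l i)) •
          (algebraMap R L (pderiv j (f i)) •
            KaehlerDifferential.D k L (algebraMap R L (X j))) = 0 := fun i => by
        rw [← Finset.smul_sum, ← hD, hf, smul_zero]
      rw [← Finset.sum_eq_zero fun i (_ : i ∈ Finset.univ) => this i, Finset.sum_comm]
      refine Finset.sum_congr rfl fun j _ => ?_
      simp only [P, Matrix.mul_apply, map_sum, map_mul, Finset.sum_smul, mul_smul,
        Matrix.map_apply, Matrix.of_apply]
    intro j
    -- Cramer's rule: the adjugate turns `P · dX = 0` into `det P · dX j = 0`, and `det P` is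
    -- non-zero in the field `L`.
    have hadj : ∑ l, algebraMap R L (P.adjugate j l) • ∑ j', algebraMap R L (P l j') •
        KaehlerDifferential.D k L (algebraMap R L (X j')) = 0 := by
      simp only [hP, smul_zero, Finset.sum_const_zero]
    simp only [Finset.smul_sum] at hadj
    rw [Finset.sum_comm] at hadj
    simp only [smul_smul, ← Finset.sum_smul, ← map_mul, ← map_sum, ← Matrix.mul_apply,
      Matrix.adjugate_mul, Matrix.smul_apply, Matrix.one_apply, smul_eq_mul, mul_ite, mul_one,
      mul_zero] at hadj
    simp only [apply_ite (algebraMap R L), map_zero, ite_smul, zero_smul, Finset.sum_ite_eq,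
      Finset.mem_univ, if_true] at hadj
    refine (smul_eq_zero.mp hadj).resolve_left ?_
    exact (map_ne_zero_iff _ (IsFractionRing.injective R L)).mpr hN
  have hR : ∀ r : R, KaehlerDifferential.D k L (algebraMap R L r) = 0 := by
    intro r
    rw [hD]
    exact Finset.sum_eq_zero fun j _ => by rw [hX, smul_zero]
  have hL : ∀ x : L, KaehlerDifferential.D k L x = 0 := by
    intro x
    obtain ⟨r, s, hs, rfl⟩ := IsFractionRing.div_surjective (A := R) x
    rw [Derivation.leibniz_div]
    simp [hR]
  have hsub : Subsingleton (Ω[L⁄k]) := by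
    rw [← Submodule.subsingleton_iff L, ← subsingleton_iff_bot_eq_top, ← KaehlerDifferential.span_range_derivation,
      eq_comm, Submodule.span_eq_bot]
    rintro _ ⟨x, rfl⟩
    exact hL x
  have : Algebra.FormallyUnramified k L := ⟨hsub⟩
  have : Algebra.EssFiniteType K L := Algebra.EssFiniteType.comp K R L
  have : Algebra.EssFiniteType k L := Algebra.EssFiniteType.of_comp K k L
  have : Algebra.IsSeparable k L := Algebra.FormallyUnramified.isSeparable k L
  have halg : IsAlgebraic k (algebraMap R L (X j)) := Algebra.IsAlgebraic.isAlgebraic _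
  have halg' : IsAlgebraic (Algebra.adjoin K F) (algebraMap R L (X j)) :=
    (IsFractionRing.isAlgebraic_iff (Algebra.adjoin K F) k L).mpr halg
  have hmap : (Algebra.adjoin K (Set.range f)).map (IsScalarTower.toAlgHom K R L) =
      Algebra.adjoin K F := AlgHom.map_adjoin _ _
  let g : Algebra.adjoin K (Set.range f) →ₐ[K] Algebra.adjoin K F :=
    ((IsScalarTower.toAlgHom K R L).comp (Algebra.adjoin K (Set.range f)).val).codRestrict _
      fun x => hmap ▸ ⟨x, x.2, rfl⟩
  refine halg'.of_ringHom_of_comp_eq g (algebraMap R L) ?_ (IsFractionRing.injective R L) rfl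
  rintro ⟨y, hy⟩
  obtain ⟨x, hx, rfl⟩ : y ∈ (Algebra.adjoin K (Set.range f)).map (IsScalarTower.toAlgHom K R L) :=
    hmap ▸ hy
  exact ⟨⟨x, hx⟩, rfl⟩

/-- Generic finiteness of the fibres of a polynomial map whose Jacobian matrix is injective at one
point. -/
theorem exists_finite_fiber_of_jacobian [CharZero K] (f : ι → MvPolynomial σ K) (a : σ → K)
    (hJ : ∀ v : σ → K,
      (∀ i, eval a (mkDerivation K (fun j => (C (v j) : MvPolynomial σ K)) (f i)) = 0) → v = 0) :
    ∃ p : MvPolynomial σ K, p ≠ 0 ∧ ∀ x : σ → K, eval x p ≠ 0 →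
      {y : σ → K | ∀ i, eval y (f i) = eval x (f i)}.Finite := by
  classical
  choose h h0 hh using fun j => isAlgebraic_X_adjoin_of_jacobian f a hJ j
  refine ⟨∏ j, ((h j).leadingCoeff : MvPolynomial σ K), ?_, fun x hx => ?_⟩
  -- Where no leading coefficient vanishes, each algebraic relation specializes to a non-zero
  -- polynomial.
  · exact Finset.prod_ne_zero_iff.mpr fun j _ => by simpa using h0 j
  rw [map_prod, Finset.prod_ne_zero_iff] at hx
  let ψ : Algebra.adjoin K (Set.range f) →ₐ[K] K :=
    (aeval x).comp (Algebra.adjoin K (Set.range f)).val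
  have hne : ∀ j, (h j).map ψ.toRingHom ≠ 0 := by
    intro j h1
    refine hx j (Finset.mem_univ j) ?_
    have := congrArg (fun q => q.coeff (h j).natDegree) h1
    simpa [ψ, Polynomial.coeff_map, coe_aeval_eq_eval] using this
  refine (Set.Finite.pi' fun j => ((h j).map ψ.toRingHom).rootSet_finite K).subset fun y hy j => ?_
  -- The coefficients are polynomials in the `f i`, so they take the same values at `y` as at `x`;
  -- thus `y j` is a root of the relation specialized at `x`.
  have hy' : ((aeval y).comp (Algebra.adjoin K (Set.range f)).val :
      Algebra.adjoin K (Set.range f) →ₐ[K] K) = ψ := by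
    apply AlgHom.adjoin_ext
    rintro _ ⟨i, rfl⟩
    have := hy i
    simpa [ψ, coe_aeval_eq_eval] using this
  rw [Polynomial.mem_rootSet]
  refine ⟨hne j, ?_⟩
  have h2 := congrArg (aeval y : MvPolynomial σ K →ₐ[K] K).toRingHom (hh j)
  rw [map_zero, Polynomial.aeval_def, Polynomial.hom_eval₂] at h2
  rw [Polynomial.coe_aeval_eq_eval, Polynomial.eval_map, ← hy']
  simpa [Polynomial.eval₂_eq_sum_range] using h2

end MvPolynomial

/-! ### The image map and its Jacobian at a sample scene -/

namespace DeformingScene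

open MvPolynomial

/-- Index set for the parameters of a deforming scene together with a scale for each of the
points of the three images. -/
abbrev ScaledIndex (m : ℕ) : Type := ParamIndex m ⊕ (Fin 3 × Fin (4 + m))

section GenericScene

variable (K : Type*) [Field K] (m : ℕ)

/-- The matrix of indeterminates of the deformation. -/
noncomputable def genericMatrix : Matrix (Fin 3) (Fin 3) (MvPolynomial (ScaledIndex m) K) :=
  Matrix.of fun i j => X (Sum.inl (Sum.inl (i, j)))

/-- The vector of indeterminates of the translation of the deformation. -/
noncomputable def genericTranslation : Fin 3 → MvPolynomial (ScaledIndex m) K :=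
  fun j => X (Sum.inl (Sum.inr (Sum.inl j)))

/-- The vector of indeterminates of the point number `n`. -/
noncomputable def genericPoint (n : Fin (4 + m)) : Fin 3 → MvPolynomial (ScaledIndex m) K :=
  fun j => X (Sum.inl (Sum.inr (Sum.inr (n, j))))

/-- The three successive positions of the generic point number `n`. -/
noncomputable def genericOrbit (n : Fin (4 + m)) : Fin 3 → Fin 3 → MvPolynomial (ScaledIndex m) K :=
  ![genericPoint K m n,
    genericMatrix K m *ᵥ genericPoint K m n + genericTranslation K m,
    genericMatrix K m *ᵥ (genericMatrix K m *ᵥ genericPoint K m n + genericTranslation K m)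
      + genericTranslation K m]

/-- The image map of the camera `[1; 0]`: all rescaled positions of the points, and the
scale of the first of them. -/
noncomputable def genericImages : Option (Fin 3 × Fin (4 + m) × Fin 3) → MvPolynomial (ScaledIndex m) K
  | none => X (Sum.inr (0, Fin.castAdd m 0))
  | some (k, n, r) => X (Sum.inr (k, n)) * genericOrbit K m n k r

/-- The points of a scene at which the Jacobian matrix of the image map is injective. -/
def samplePoints : Fin (4 + m) → Fin 3 → K :=
  Fin.append ![![0, -1, 0], ![1, 0, 0], ![0, 1, 0], ![0, 0, 1]] fun _ => ![1, 0, 0]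

/-- A scene, with all scales equal to `1`, at which the Jacobian matrix of the image map is
injective. -/
def sampleScene : ScaledIndex m → K :=
  Sum.elim (Sum.elim (fun ij => !![0, 1, 0; 0, 0, 0; -1, 0, -1] ij.1 ij.2)
    (Sum.elim ![0, 1, 0] fun nk => samplePoints K m nk.1 nk.2)) fun _ => 1

variable {K m} [CharZero K]

/-- The first four points already suffice, and the count is tight: 36 unknowns against 36 image
equations, which always leave the scaling direction free, plus the normalization. The sample
deformation may be singular, since only the Jacobian matters. -/
theorem eval_mkDerivation_genericImages (v : ScaledIndex m → K)
    (hv : ∀ i, eval (sampleScene K m)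
      (mkDerivation K (fun j => (C (v j) : MvPolynomial (ScaledIndex m) K))
        (genericImages K m i)) = 0) : v = 0 := by
  obtain ⟨b, hb⟩ : ∃ b : Fin 3 → Fin 3 → K, ∀ i j, v (Sum.inl (Sum.inl (i, j))) = b i j :=
    ⟨_, fun _ _ => rfl⟩
  obtain ⟨s, hs⟩ : ∃ s : Fin 3 → K, ∀ j, v (Sum.inl (Sum.inr (Sum.inl j))) = s j :=
    ⟨_, fun _ => rfl⟩
  obtain ⟨x, hx⟩ : ∃ x : Fin (4 + m) → Fin 3 → K,
    ∀ n j, v (Sum.inl (Sum.inr (Sum.inr (n, j)))) = x n j := ⟨_, fun _ _ => rfl⟩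
  obtain ⟨l, hl⟩ : ∃ l : Fin 3 → Fin (4 + m) → K, ∀ k n, v (Sum.inr (k, n)) = l k n :=
    ⟨_, fun _ _ => rfl⟩
  have h0 : l 0 (Fin.castAdd m 0) = 0 := by
    simpa [genericImages, hl] using hv none
  have e := fun n k r => hv (some (k, n, r))
  simp only [genericImages, Fin.forall_fin_succ, genericOrbit, genericPoint, genericMatrix,
    genericTranslation, Matrix.mulVec, dotProduct, Fin.sum_univ_three, Pi.add_apply, Matrix.of_apply,
    Derivation.leibniz, mkDerivation_X, map_add, map_mul, eval_X, eval_C, smul_eq_mul, hb, hs, hx, hl,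
    sampleScene, Sum.elim_inl, Sum.elim_inr,
    Matrix.cons_val_zero, Matrix.cons_val_one, Matrix.cons_val_succ] at e
  have e0 := e (Fin.castAdd m 0)
  have e1 := e (Fin.castAdd m 1)
  have e2 := e (Fin.castAdd m 2)
  have e3 := e (Fin.castAdd m 3)
  have ei := fun i => e (Fin.natAdd 4 i)
  clear e hv
  simp [samplePoints, Fin.append_left, Fin.append_right, h0] at e0 e1 e2 e3 ei
  obtain ⟨hb', hs', hx0, hx1, hx2, hx3, hl0, hl1, hl2, hl3⟩ :
      (∀ i j, b i j = 0) ∧ (∀ i, s i = 0) ∧ (∀ j, x (Fin.castAdd m 0) j = 0) ∧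
      (∀ j, x (Fin.castAdd m 1) j = 0) ∧ (∀ j, x (Fin.castAdd m 2) j = 0) ∧
      (∀ j, x (Fin.castAdd m 3) j = 0) ∧ (∀ j, l j (Fin.castAdd m 0) = 0) ∧
      (∀ j, l j (Fin.castAdd m 1) = 0) ∧ (∀ j, l j (Fin.castAdd m 2) = 0) ∧
      (∀ j, l j (Fin.castAdd m 3) = 0) := by
    simp only [Fin.forall_fin_succ, Fin.succ_zero_eq_one, Fin.succ_one_eq_two, IsEmpty.forall_iff,
      and_true]
    clear ei hb hs hx hl
    grind
  -- Once the variation of the deformation vanishes, each further point has its own system: 9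
  -- equations in 6 unknowns.
  have hi : ∀ i, (∀ j, x (Fin.natAdd 4 i) j = 0) ∧ ∀ j, l j (Fin.natAdd 4 i) = 0 := by
    intro i
    have := ei i
    simp only [hb', hs', Fin.forall_fin_succ, Fin.succ_zero_eq_one, Fin.succ_one_eq_two,
      IsEmpty.forall_iff, and_true] at this ⊢
    grind
  have hx' : ∀ n j, x n j = 0 := by
    intro n
    refine Fin.addCases (fun c => ?_) (fun i => (hi i).1) n
    fin_cases c <;> assumption
  have hl' : ∀ n k, l k n = 0 := by
    intro n
    refine Fin.addCases (fun c => ?_) (fun i => (hi i).2) n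
    fin_cases c <;> assumption
  funext t
  rcases t with (⟨i, j⟩ | j | ⟨n, j⟩) | ⟨k, n⟩
  · exact (hb i j).trans (hb' i j)
  · exact (hs j).trans (hs' j)
  · exact (hx n j).trans (hx' n j)
  · exact (hl k n).trans (hl' n k)

end GenericScene
end DeformingScene

/-! ### Reduction to the camera `[1; 0]` -/

namespace DeformingScene

open MvPolynomial

section CameraFrame

variable {K : Type*} [RCLike K] {m : ℕ}

/-- The left `3 × 3` block of a camera. -/
def leftBlock (C : Matrix (Fin 3) (Fin 4) K) : Matrix (Fin 3) (Fin 3) K :=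
  C.submatrix id Fin.castSucc

/-- The coordinates of a point in the frame where the camera `C` becomes `[1; 0]`. -/
def toFrame (C : Matrix (Fin 3) (Fin 4) K) (P : Fin 3 → K) : Fin 3 → K :=
  leftBlock C *ᵥ P + C.col 3

/-- The matrix of an affine deformation in the frame where the camera `C` becomes `[1; 0]`. -/
noncomputable def frameMatrix (C : Matrix (Fin 3) (Fin 4) K) (A : Matrix (Fin 3) (Fin 3) K) :
    Matrix (Fin 3) (Fin 3) K :=
  leftBlock C * A * (leftBlock C)⁻¹

/-- The translation of an affine deformation in the frame where the camera `C` becomes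
`[1; 0]`. -/
noncomputable def frameTranslation (C : Matrix (Fin 3) (Fin 4) K) (A : Matrix (Fin 3) (Fin 3) K)
    (t : Fin 3 → K) : Fin 3 → K :=
  leftBlock C *ᵥ t + C.col 3 - frameMatrix C A *ᵥ C.col 3

/-- The three successive positions of a point. -/
def orbit (B : Matrix (Fin 3) (Fin 3) K) (s X : Fin 3 → K) : Fin 3 → Fin 3 → K :=
  ![X, deform B s X, deform B s (deform B s X)]

theorem mulVec_homog (C : Matrix (Fin 3) (Fin 4) K) (P : Fin 3 → K) :
    C *ᵥ homog P = toFrame C P := by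
  ext i
  simp [toFrame, leftBlock, homog, Matrix.mulVec, dotProduct, Fin.sum_univ_succ, Matrix.col,
    add_assoc]

theorem IsPinholeCamera.isUnit_det {C : Matrix (Fin 3) (Fin 4) K} (hC : IsPinholeCamera C) :
    IsUnit (leftBlock C).det :=
  isUnit_iff_ne_zero.mpr hC

theorem toFrame_deform {C : Matrix (Fin 3) (Fin 4) K} (hC : IsPinholeCamera C)
    (A : Matrix (Fin 3) (Fin 3) K) (t P : Fin 3 → K) :
    toFrame C (deform A t P) = deform (frameMatrix C A) (frameTranslation C A t) (toFrame C P) := by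
  have h : frameMatrix C A *ᵥ (leftBlock C *ᵥ P) = leftBlock C *ᵥ (A *ᵥ P) := by
    rw [frameMatrix, Matrix.mulVec_mulVec, Matrix.mul_assoc,
      Matrix.nonsing_inv_mul _ hC.isUnit_det, Matrix.mul_one, Matrix.mulVec_mulVec]
  simp only [toFrame, deform, frameTranslation, Matrix.mulVec_add, h]
  abel

/-- Every scene in the frame of the camera comes from a scene. -/
theorem exists_frame_eq {C : Matrix (Fin 3) (Fin 4) K} (hC : IsPinholeCamera C)
    (B : Matrix (Fin 3) (Fin 3) K) (s : Fin 3 → K) (X : Fin (4 + m) → Fin 3 → K) :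
    ∃ A t, ∃ P : Fin (4 + m) → Fin 3 → K, frameMatrix C A = B ∧ frameTranslation C A t = s ∧
      ∀ n, toFrame C (P n) = X n := by
  have h1 := Matrix.mul_nonsing_inv _ hC.isUnit_det
  have hA : frameMatrix C ((leftBlock C)⁻¹ * B * leftBlock C) = B := by
    rw [frameMatrix, ← Matrix.mul_assoc, ← Matrix.mul_assoc, h1, Matrix.one_mul, Matrix.mul_assoc,
      h1, Matrix.mul_one]
  refine ⟨(leftBlock C)⁻¹ * B * leftBlock C, (leftBlock C)⁻¹ *ᵥ (s - C.col 3 + B *ᵥ C.col 3),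
    fun n => (leftBlock C)⁻¹ *ᵥ (X n - C.col 3), hA, ?_, fun n => ?_⟩
  · rw [frameTranslation, hA, Matrix.mulVec_mulVec, h1, Matrix.one_mulVec]
    abel
  · rw [toFrame, Matrix.mulVec_mulVec, h1, Matrix.one_mulVec, sub_add_cancel]

theorem deform_smul (B : Matrix (Fin 3) (Fin 3) K) (s X : Fin 3 → K) (c : K) :
    deform B (c • s) (c • X) = c • deform B s X := by
  simp only [deform, Matrix.mulVec_smul, smul_add]

theorem orbit_smul (B : Matrix (Fin 3) (Fin 3) K) (s X : Fin 3 → K) (c : K) (k : Fin 3) :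
    orbit B (c • s) (c • X) k = c • orbit B s X k := by
  fin_cases k <;> simp [orbit, deform_smul]

theorem Produces.exists_scales {C : Matrix (Fin 3) (Fin 4) K} {A : Matrix (Fin 3) (Fin 3) K}
    {t : Fin 3 → K} {P q q' q'' : Fin (4 + m) → Fin 3 → K} (h : Produces C A t P q q' q'') :
    ∃ c : Fin 3 → Fin (4 + m) → K, ∀ k n, c k n ≠ 0 ∧ ![q, q', q''] k n =
      c k n • orbit (frameMatrix C A) (frameTranslation C A t) (toFrame C (P n)) k := by
  choose _ c₁ h₁ using h.image₁
  choose _ c₂ h₂ using h.image₂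
  choose _ c₃ h₃ using h.image₃
  simp only [mulVec_homog, toFrame_deform h.camera] at h₁ h₂ h₃
  refine ⟨![c₁, c₂, c₃], fun k n => ?_⟩
  fin_cases k
  exacts [h₁ n, h₂ n, h₃ n]

theorem HasAffineCoords.smul_toFrame {P : Fin (4 + m) → Fin 3 → K} {κ : Fin m → Fin 3 → K}
    (h : HasAffineCoords P κ) (C : Matrix (Fin 3) (Fin 4) K) (c : K) :
    HasAffineCoords (fun n => c • toFrame C (P n)) κ := by
  intro i
  simp only [toFrame, h i, Matrix.mulVec_add, Matrix.mulVec_smul]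
  module

theorem affineIndependent_smul_toFrame {ι : Type*} {P : ι → Fin 3 → K}
    (h : AffineIndependent K P) {C : Matrix (Fin 3) (Fin 4) K} (hC : IsPinholeCamera C) {c : K}
    (hc : c ≠ 0) : AffineIndependent K fun n => c • toFrame C (P n) := by
  let f : (Fin 3 → K) →ᵃ[K] (Fin 3 → K) :=
    c • ((leftBlock C).mulVecLin.toAffineMap + AffineMap.const K _ (C.col 3))
  refine h.map' f fun x y hxy => ?_
  have h1 : c • toFrame C x = c • toFrame C y := hxy
  exact Matrix.mulVec_injective_of_isUnit
    ((Matrix.isUnit_iff_isUnit_det _).mpr hC.isUnit_det)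
    (add_right_cancel (smul_right_injective _ hc h1))

/-- The difference of two coordinate families gives weights of sum zero annihilating the affine
basis. -/
theorem HasAffineCoords.unique {P : Fin (4 + m) → Fin 3 → K}
    (hP : AffineIndependent K fun j : Fin 4 => P (Fin.castAdd m j)) {κ κ' : Fin m → Fin 3 → K}
    (h : HasAffineCoords P κ) (h' : HasAffineCoords P κ') : κ = κ' := by
  funext i
  let d : Fin 3 → K := κ i - κ' i
  have hd := affineIndependent_iff.mp hP Finset.univ ![d 0, d 1, d 2, -(d 0 + d 1 + d 2)]
    (by simp [Fin.sum_univ_four]) (by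
      simp only [Fin.sum_univ_four, d, Pi.sub_apply, Matrix.cons_val]
      rw [← sub_self (P (Fin.natAdd 4 i))]
      nth_rw 1 [h i]
      rw [h' i]
      module)
  funext j
  refine sub_eq_zero.mp ?_
  fin_cases j
  exacts [hd 0 (Finset.mem_univ _), hd 1 (Finset.mem_univ _), hd 2 (Finset.mem_univ _)]

/-- The vector of the parameters of a scene and of the scales of its images. -/
def scaledParams (B : Matrix (Fin 3) (Fin 3) K) (s : Fin 3 → K) (X : Fin (4 + m) → Fin 3 → K)
    (l : Fin 3 → Fin (4 + m) → K) : ScaledIndex m → K :=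
  Sum.elim (params B s X) fun kn => l kn.1 kn.2

theorem eval_genericImages (B : Matrix (Fin 3) (Fin 3) K) (s : Fin 3 → K)
    (X : Fin (4 + m) → Fin 3 → K) (l : Fin 3 → Fin (4 + m) → K) (k : Fin 3) (n : Fin (4 + m))
    (r : Fin 3) : eval (scaledParams B s X l) (genericImages K m (some (k, n, r))) =
      l k n * orbit B s (X n) k r := by
  fin_cases k <;>
  simp [genericImages, genericOrbit, genericMatrix, genericPoint, genericTranslation, orbit,
    deform, scaledParams, params, Matrix.mulVec, dotProduct]

/-- Substituting the parameters of a scene in the frame of a camera for those of the scene, and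
constants for the scales, is polynomial. -/
theorem exists_eval_frame (C : Matrix (Fin 3) (Fin 4) K) (l : Fin 3 → Fin (4 + m) → K)
    (p : MvPolynomial (ScaledIndex m) K) :
    ∃ p' : MvPolynomial (ParamIndex m) K, ∀ A t P, eval (params A t P) p' =
      eval (scaledParams (frameMatrix C A) (frameTranslation C A t)
        (fun n => toFrame C (P n)) l) p := by
  suffices h : ∀ j, ∃ g : MvPolynomial (ParamIndex m) K, ∀ A t P, eval (params A t P) g =
      scaledParams (frameMatrix C A) (frameTranslation C A t) (fun n => toFrame C (P n)) l j by
    choose g hg using h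
    refine ⟨aeval g p, fun A t P => ?_⟩
    refine (eval₂Hom_bind₁ (RingHom.id K) (params A t P) g p).trans ?_
    exact congrArg (fun z => eval z p) (funext fun j => hg j A t P)
  have hB : ∀ i j, ∃ g : MvPolynomial (ParamIndex m) K, ∀ A t P, eval (params A t P) g =
      frameMatrix C A i j := fun i j =>
    ⟨∑ b, (∑ a, MvPolynomial.C (leftBlock C i a) * X (Sum.inl (a, b))) *
      MvPolynomial.C ((leftBlock C)⁻¹ b j),
      fun A t P => by simp [frameMatrix, Matrix.mul_apply, params]⟩
  choose g hg using hB
  rintro ((⟨i, j⟩ | i | ⟨n, i⟩) | ⟨k, n⟩)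
  · exact ⟨g i j, hg i j⟩
  · refine ⟨∑ j, MvPolynomial.C (leftBlock C i j) * X (Sum.inr (Sum.inl j)) +
      MvPolynomial.C (C i 3) - ∑ j, g i j * MvPolynomial.C (C j 3), fun A t P => ?_⟩
    simp only [map_sub, map_add, map_sum, map_mul, eval_C, eval_X, hg]
    simp [scaledParams, params, frameTranslation, Matrix.mulVec, dotProduct]
  · refine ⟨∑ j, MvPolynomial.C (leftBlock C i j) * X (Sum.inr (Sum.inr (n, j))) +
      MvPolynomial.C (C i 3), fun A t P => ?_⟩
    simp [scaledParams, params, toFrame, Matrix.mulVec, dotProduct]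
  · exact ⟨MvPolynomial.C (l k n), fun A t P => by simp [scaledParams]⟩

end CameraFrame

end DeformingScene

/-! ### Generic finiteness of the affine structures -/

open DeformingScene in
theorem mainTheorem4 {K : Type*} [RCLike K] (m : ℕ) (C : Matrix (Fin 3) (Fin 4) K)
    (hC : DeformingScene.IsPinholeCamera C) :
    ∃ p : MvPolynomial (DeformingScene.ParamIndex m) K, p ≠ 0 ∧
      ∀ (A : Matrix (Fin 3) (Fin 3) K) (t : Fin 3 → K) (P : Fin (4 + m) → Fin 3 → K)
        (q q' q'' : Fin (4 + m) → Fin 3 → K),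
        MvPolynomial.eval (DeformingScene.params A t P) p ≠ 0 →
        DeformingScene.Produces C A t P q q' q'' →
        (DeformingScene.affineStructures q q' q'').Finite := by
  obtain ⟨p, hp, hfin⟩ := MvPolynomial.exists_finite_fiber_of_jacobian (genericImages K m)
    (sampleScene K m) eval_mkDerivation_genericImages
  obtain ⟨y, hy⟩ : ∃ y, MvPolynomial.eval y p ≠ 0 := by
    by_contra! h
    exact hp (MvPolynomial.funext fun y => by rw [h, map_zero])
  -- Images fix no scales, so the scales may be frozen at values where `p` is not identically zero
  -- in the scene parameters.
  let l : Fin 3 → Fin (4 + m) → K := fun k n => y (Sum.inr (k, n))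
  obtain ⟨p', hp'⟩ := exists_eval_frame C l p
  refine ⟨p', fun h => ?_, fun A t P q q' q'' hne hprod => ?_⟩
  · obtain ⟨A, t, P, hA, ht, hP⟩ := exists_frame_eq hC
      (Matrix.of fun i j => y (Sum.inl (Sum.inl (i, j)))) (fun j => y (Sum.inl (Sum.inr (Sum.inl j))))
      (fun (n : Fin (4 + m)) j => y (Sum.inl (Sum.inr (Sum.inr (n, j)))))
    have h1 := hp' A t P
    rw [h, map_zero, hA, ht, funext hP] at h1
    refine hy (Eq.trans ?_ h1.symm)
    congr 2
    funext j
    rcases j with (⟨i, j⟩ | j | ⟨n, j⟩) | ⟨k, n⟩ <;> rfl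
  rw [hp'] at hne
  obtain ⟨c, hc⟩ := hprod.exists_scales
  have key : ∀ κ ∈ affineStructures q q' q'', ∃ z : ScaledIndex m → K,
      (∀ i, MvPolynomial.eval z (genericImages K m i) = MvPolynomial.eval (scaledParams
        (frameMatrix C A) (frameTranslation C A t) (fun n => toFrame C (P n)) l)
          (genericImages K m i)) ∧
      AffineIndependent K (fun (j : Fin 4) i =>
        z (Sum.inl (Sum.inr (Sum.inr (Fin.castAdd m j, i))))) ∧
      HasAffineCoords (fun n i => z (Sum.inl (Sum.inr (Sum.inr (n, i))))) κ := by
    rintro κ ⟨C', A', t', P', hprod', hκ⟩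
    obtain ⟨c', hc'⟩ := hprod'.exists_scales
    let n₀ := Fin.castAdd m (0 : Fin 4)
    -- This factor makes the first scale of the competitor equal to `l 0 n₀`, as the normalization
    -- demands; the other scales are then forced by equality of the images.
    let ρ : K := c' 0 n₀ / c 0 n₀
    have hρ : ρ ≠ 0 := div_ne_zero (hc' 0 n₀).1 (hc 0 n₀).1
    refine ⟨scaledParams (frameMatrix C' A') (ρ • frameTranslation C' A' t')
      (fun n => ρ • toFrame C' (P' n)) (fun k n => l k n * c' k n / (c k n * ρ)), ?_,
      affineIndependent_smul_toFrame hprod'.basis hprod'.camera hρ, hκ.smul_toFrame C' ρ⟩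
    rintro (_ | ⟨k, n, r⟩)
    · have h1 := (hc' 0 n₀).1
      have h2 := (hc 0 n₀).1
      simp only [genericImages, MvPolynomial.eval_X, scaledParams, Sum.elim_inr]
      change l 0 n₀ * c' 0 n₀ / (c 0 n₀ * (c' 0 n₀ / c 0 n₀)) = l 0 n₀
      field_simp
    · rw [eval_genericImages, eval_genericImages, orbit_smul]
      have h1 := (hc k n).1
      have h2 := congrFun ((hc' k n).2.symm.trans (hc k n).2) r
      simp only [Pi.smul_apply, smul_eq_mul] at h2 ⊢
      field_simp
      linear_combination l k n * h2
  choose! z hz hind hcoord using key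
  -- Injectivity of `z`: the points stored in `z κ` contain an affine basis and so determine `κ`.
  refine Set.Finite.of_injOn (f := z) ?_ ?_ (hfin _ hne)
  · exact fun κ hκ => hz κ hκ
  intro κ hκ κ' hκ' h
  have h1 := hcoord κ' hκ'
  rw [← h] at h1
  exact (hcoord κ hκ).unique (hind κ hκ) h1
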